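/- Fix a set $\boldsymbol P$ of monadic predicates. Formulas of $\mathrm{FO}(<,+1)$ are given by $\varphi ::= \mathbf{true}\mid P(t)\mid t<t\mid \varphi\wedge\varphi\mid\neg\varphi\mid\exists z\,\varphi$ with $P\in\boldsymbol P$ and terms $t ::= z\mid t+1$ ($z$ a variable), and are interpreted over the real line $(\mathbb R,<,+1)$, a signal $f:\mathbb R\to 2^{\boldsymbol P}$ interpreting each $P$ as $\{r : P\in f(r)\}$. Formulas of Metric Temporal Logic (MTL) are given by $\psi ::= \mathbf{true}\mid P\mid \psi\wedge\psi\mid\neg\psi\mid \psi\,\mathbf U_I\,\psi\mid\psi\,\mathbf S_I\,\psi$, where $I\subseteq(0,\infty)$ ranges over the intervals with endpoints in $\mathbb Q_{\ge 0}\cup\{\infty\}$. Here $f,r\models P$ iff $P\in f(r)$, the Boolean connectives have their usual meaning, $f,r\models\psi_1\,\mathbf U_I\,\psi_2$ iff there is $t>r$ with $t-r\in I$, $f,t\models\psi_2$ and $f,u\models\psi_1$ for all $u\in(r,t)$, and $f,r\models\psi_1\,\mathbf S_I\,\psi_2$ iff there is $t<r$ with $r-t\in I$, $f,t\models\psi_2$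 and $f,u\models\psi_1$ for all $u\in(t,r)$. Let $N\in\mathbb N$. A formula $\varphi(x)$ of $\mathrm{FO}(<,+1)$ with no free variable other than $x$ is called $N$-bounded if (i) each subformula of $\varphi$ that begins with a quantifier has the form $\exists z\,\big((x-N\le z<x+N)\wedge\chi\big)$ with $z$ a variable different from $x$ (where $x-N\le z<x+N$ abbreviates $\neg(z+N<x)\wedge z<x+N$, and $+N$ is the $N$-fold application of $+1$), and (ii) in each atomic subformula $P(t)$ of $\varphi$ the term $t$ is a bound occurrence of a variable. Theorem. For every $N\in\mathbb N$ and every $N$-bounded $\mathrm{FO}(<,+1)$ formula $\varphi(x)$ there is an MTL formula $\varphi^\dagger$ (over the same $\boldsymbol P$) that is equivalent to $\varphi$: for all signals $f:\mathbb R\to 2^{\boldsymbol P}$ and all $r\in\mathbb R$, $f\models\varphi[r]$ if and only if $f,r\models\varphi^\dagger$. -/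

import Mathlib

/-- Signals over a set `P` of monadic predicates (atomic propositions): functions `ℝ → 2^P`. -/
abbrev Signal (P : Type*) := ℝ → Set P

namespace FOOne

/-- Terms of `FO(<,+1)`: `t ::= x | t + 1`, with variables named by natural numbers. -/
inductive Term : Type
  | var (x : ℕ) : Term
  | succ (t : Term) : Term

/-- The term `t + 1 + ⋯ + 1`, with `n` applications of the function `+1`. -/
def Term.addNat (t : Term) : ℕ → Term
  | 0 => t
  | n + 1 => (t.addNat n).succ

/-- The set of variables of a term (a term has exactly one). -/
def Term.vars : Term → Set ℕ
  | .var x => {x}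
  | .succ t => t.vars

/-- The value of a term over the real line under an assignment. -/
def Term.eval (v : ℕ → ℝ) : Term → ℝ
  | .var x => v x
  | .succ t => t.eval v + 1

/-- Formulas of `FO(<,+1)` over the monadic predicates `P`:
`φ ::= true | p(t) | t < t | φ ∧ φ | ¬ φ | ∃ x φ`. -/
inductive Formula (P : Type*)
  | tru : Formula P
  | pred (p : P) (t : Term) : Formula P
  | lt (s t : Term) : Formula P
  | and (φ ψ : Formula P) : Formula P
  | neg (φ : Formula P) : Formula P
  | ex (x : ℕ) (φ : Formula P) : Formula P

/-- The free variables of a formula. -/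
def Formula.freeVars {P : Type*} : Formula P → Set ℕ
  | .tru => ∅
  | .pred _ t => t.vars
  | .lt s t => s.vars ∪ t.vars
  | .and φ ψ => φ.freeVars ∪ ψ.freeVars
  | .neg φ => φ.freeVars
  | .ex x φ => φ.freeVars \ {x}

/-- Satisfaction of an `FO(<,+1)` formula over the real line, where the monadic predicates are
interpreted by the signal `f` and the free variables by the assignment `v`. -/
def Formula.Sat {P : Type*} (f : Signal P) : (ℕ → ℝ) → Formula P → Prop
  | _, .tru => True
  | v, .pred p t => p ∈ f (t.eval v)
  | v, .lt s t => s.eval v < t.eval v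
  | v, .and φ ψ => φ.Sat f v ∧ ψ.Sat f v
  | v, .neg φ => ¬ φ.Sat f v
  | v, .ex x φ => ∃ r : ℝ, φ.Sat f (Function.update v x r)

/-- The formula `x - N ≤ z < x + N`, written in the signature as `¬ (z + N < x) ∧ z < x + N`. -/
def Formula.between {P : Type*} (N x z : ℕ) : Formula P :=
  .and (.neg (.lt ((Term.var z).addNat N) (.var x))) (.lt (.var z) ((Term.var x).addNat N))

/-- `InBet N x B φ`: the formula `φ`, read in the scope of quantifiers binding exactly the
variables in `B`, belongs to `Bet(x - N, x + N)`:
* every quantified subformula has the form `∃ z ((x - N ≤ z < x + N) ∧ χ)`, where `z` is not the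
  reference variable `x` (which would otherwise be captured);
* in every atomic subformula `p(t)` the term `t` is a bound occurrence of a variable. -/
inductive Formula.InBet {P : Type*} (N x : ℕ) : Set ℕ → Formula P → Prop
  | tru (B : Set ℕ) : InBet N x B .tru
  | pred (B : Set ℕ) (p : P) (y : ℕ) (hy : y ∈ B) : InBet N x B (.pred p (.var y))
  | lt (B : Set ℕ) (s t : Term) : InBet N x B (.lt s t)
  | and (B : Set ℕ) (φ ψ : Formula P) (hφ : InBet N x B φ) (hψ : InBet N x B ψ) :
      InBet N x B (.and φ ψ)
  | neg (B : Set ℕ) (φ : Formula P) (hφ : InBet N x B φ) : InBet N x B (.neg φ)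
  | ex (B : Set ℕ) (z : ℕ) (hz : z ≠ x) (χ : Formula P) (hχ : InBet N x (insert z B) χ) :
      InBet N x B (.ex z (.and (.between N x z) χ))

/-- The formula `φ = φ(x)` has no free variable other than `x` and is `N`-bounded. -/
def Formula.IsBounded {P : Type*} (N x : ℕ) (φ : Formula P) : Prop :=
  φ.freeVars ⊆ {x} ∧ φ.InBet N x ∅

end FOOne

namespace MTL

/-- Intervals `I ⊆ (0, ∞)` with endpoints in `ℚ≥0 ∪ {∞}`; the left endpoint may only be
included if it is positive. -/
inductive TimeInterval : Type
  | Ioo (a b : ℚ≥0) : TimeInterval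
  | Ioc (a b : ℚ≥0) : TimeInterval
  | Ico (a b : ℚ≥0) (ha : 0 < a) : TimeInterval
  | Icc (a b : ℚ≥0) (ha : 0 < a) : TimeInterval
  | Ioi (a : ℚ≥0) : TimeInterval
  | Ici (a : ℚ≥0) (ha : 0 < a) : TimeInterval

/-- The set of reals denoted by an interval. -/
def TimeInterval.toSet : TimeInterval → Set ℝ
  | .Ioo a b => Set.Ioo (a : ℝ) (b : ℝ)
  | .Ioc a b => Set.Ioc (a : ℝ) (b : ℝ)
  | .Ico a b _ => Set.Ico (a : ℝ) (b : ℝ)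
  | .Icc a b _ => Set.Icc (a : ℝ) (b : ℝ)
  | .Ioi a => Set.Ioi (a : ℝ)
  | .Ici a _ => Set.Ici (a : ℝ)

/-- Formulas of Metric Temporal Logic over the atomic propositions `P`. Here `untl I φ ψ` is
`φ U_I ψ` and `snce I φ ψ` is `φ S_I ψ`. -/
inductive Formula (P : Type*)
  | tru : Formula P
  | atom (p : P) : Formula P
  | and (φ ψ : Formula P) : Formula P
  | neg (φ : Formula P) : Formula P
  | untl (I : TimeInterval) (φ ψ : Formula P) : Formula P
  | snce (I : TimeInterval) (φ ψ : Formula P) : Formula P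

/-- The satisfaction relation `f, r ⊨ φ` of Metric Temporal Logic. -/
def Formula.Sat {P : Type*} (f : Signal P) : ℝ → Formula P → Prop
  | _, .tru => True
  | r, .atom p => p ∈ f r
  | r, .and φ ψ => φ.Sat f r ∧ ψ.Sat f r
  | r, .neg φ => ¬ φ.Sat f r
  | r, .untl I φ ψ =>
      ∃ t : ℝ, r < t ∧ t - r ∈ I.toSet ∧ ψ.Sat f t ∧ ∀ u : ℝ, r < u → u < t → φ.Sat f u
  | r, .snce I φ ψ =>
      ∃ t : ℝ, t < r ∧ r - t ∈ I.toSet ∧ ψ.Sat f t ∧ ∀ u : ℝ, t < u → u < r → φ.Sat f u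

end MTL

/-- A first-order formula `φ(x)` and an MTL formula `ψ` are equivalent: for all signals `f` and
all `r`, `φ` holds in `f` when `x` has the value `r` iff `f, r ⊨ ψ`. -/
def FOOne.Formula.Equivalent {P : Type*} (x : ℕ) (φ : FOOne.Formula P) (ψ : MTL.Formula P) :
    Prop :=
  ∀ (f : Signal P) (r : ℝ) (v : ℕ → ℝ), v x = r → (φ.Sat f v ↔ ψ.Sat f r)

/-! A bounded formula only sees the points of [x - N, x + N). Each of them is p + i with p in [x, x
+ 1) and an integer -N ≤ i < N, so this window folds onto the unit interval: `label` records at p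
which predicates hold at the points p + i. Order between folded points is decided by the integer
parts and then by the order in the unit interval (`add_int_lt_add_int`). An Ehrenfeucht–Fraïssé
argument (`Match.exists_extend`, `Formula.InBet.exists_depth`) shows that the truth of the formula
depends only on the label of x and on the type, of some finite depth k, of the labelled interval (x,
x + 1). There are finitely many such pairs, so it is enough to express each of them in MTL.

Types are expressed through decomposition formulas [A₀, β₁, A₁, …, βₙ₊₁, Aₙ₊₁], which describe an
interval by finitely many inner points and by conditions on the gaps; all conditions are
MTL-definable unary predicates. Their finite unions are closed under conjunction, concatenation and
complement. Complement (`Chain.decomposable_not`) is the hard case: it uses completeness of the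
line, through the last point at which a predicate fails, and absorbs witnesses into new unary
predicates built with U and S.

Metric operators do the remaining work in `Chain.definable`: a decomposition formula over (r, r + q)
is an MTL property of r. This goes by induction on the number of inner points, cutting the interval
at its midpoint. -/

namespace MTL

variable {P : Type*}

/-! ### Closure properties of MTL-definable predicates -/

/-- A property of time points, depending on the signal, which is defined by an MTL formula. -/
def Definable (A : Signal P → ℝ → Prop) : Prop :=
  ∃ ψ : Formula P, ∀ f r, A f r ↔ ψ.Sat f r

namespace Definable

variable {A B : Signal P → ℝ → Prop}

theorem congr (hA : Definable A) (h : ∀ f r, A f r ↔ B f r) : Definable B := by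
  obtain ⟨ψ, hψ⟩ := hA
  exact ⟨ψ, fun f r => (h f r).symm.trans (hψ f r)⟩

theorem top : Definable (fun (_ : Signal P) _ => True) :=
  ⟨.tru, fun _ _ => Iff.rfl⟩

theorem atom (p : P) : Definable (fun f r => p ∈ f r) :=
  ⟨.atom p, fun _ _ => Iff.rfl⟩

theorem and (hA : Definable A) (hB : Definable B) : Definable (fun f r => A f r ∧ B f r) := by
  obtain ⟨ψ, hψ⟩ := hA
  obtain ⟨χ, hχ⟩ := hB
  exact ⟨.and ψ χ, fun f r => and_congr (hψ f r) (hχ f r)⟩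

theorem not (hA : Definable A) : Definable (fun f r => ¬ A f r) := by
  obtain ⟨ψ, hψ⟩ := hA
  exact ⟨.neg ψ, fun f r => not_congr (hψ f r)⟩

theorem or (hA : Definable A) (hB : Definable B) : Definable (fun f r => A f r ∨ B f r) :=
  (hA.not.and hB.not).not.congr fun f r => by tauto

theorem const (p : Prop) : Definable (fun (_ : Signal P) _ => p) := by
  by_cases hp : p
  · exact top.congr fun _ _ => by simp [hp]
  · exact top.not.congr fun _ _ => by simp [hp]

theorem forall_finite {ι : Type*} [Finite ι] {A : ι → Signal P → ℝ → Prop}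
    (hA : ∀ i, Definable (A i)) : Definable (fun f r => ∀ i, A i f r) := by
  classical
  have := Fintype.ofFinite ι
  have key : ∀ s : Finset ι, Definable (fun f r => ∀ i ∈ s, A i f r) := by
    intro s
    induction s using Finset.induction_on with
    | empty => exact top.congr fun _ _ => by simp
    | insert i s _ ih => exact ((hA i).and ih).congr fun f r => by simp
  exact (key Finset.univ).congr fun f r => by simp

theorem exists_finite {ι : Type*} [Finite ι] {A : ι → Signal P → ℝ → Prop}
    (hA : ∀ i, Definable (A i)) : Definable (fun f r => ∃ i, A i f r) :=
  (forall_finite fun i => (hA i).not).not.congr fun f r => by simp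

theorem untl (I : TimeInterval) (hA : Definable A) (hB : Definable B) :
    Definable (fun f r => ∃ t, r < t ∧ t - r ∈ I.toSet ∧ B f t ∧ ∀ u, r < u → u < t → A f u) := by
  obtain ⟨ψ, hψ⟩ := hA
  obtain ⟨χ, hχ⟩ := hB
  exact ⟨.untl I ψ χ, fun f r => by simp only [hψ, hχ, Formula.Sat]⟩

theorem snce (I : TimeInterval) (hA : Definable A) (hB : Definable B) :
    Definable (fun f r => ∃ t, t < r ∧ r - t ∈ I.toSet ∧ B f t ∧ ∀ u, t < u → u < r → A f u) := by
  obtain ⟨ψ, hψ⟩ := hA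
  obtain ⟨χ, hχ⟩ := hB
  exact ⟨.snce I ψ χ, fun f r => by simp only [hψ, hχ, Formula.Sat]⟩

theorem strict_until (hA : Definable A) (hB : Definable B) :
    Definable (fun f r => ∃ t, r < t ∧ (∀ u ∈ Set.Ioo r t, A f u) ∧ B f t) :=
  (untl (.Ioi 0) hA hB).congr fun f r => by
    refine exists_congr fun t => ?_
    simp only [TimeInterval.toSet, Set.mem_Ioi, Set.mem_Ioo, NNRat.cast_zero, sub_pos, and_imp]
    tauto

theorem strict_since (hA : Definable A) (hB : Definable B) :
    Definable (fun f r => ∃ t, t < r ∧ (∀ u ∈ Set.Ioo t r, A f u) ∧ B f t) :=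
  (snce (.Ioi 0) hA hB).congr fun f r => by
    refine exists_congr fun t => ?_
    simp only [TimeInterval.toSet, Set.mem_Ioi, Set.mem_Ioo, NNRat.cast_zero, sub_pos, and_imp]
    tauto

theorem until_lt (q : ℚ≥0) (hA : Definable A) (hB : Definable B) :
    Definable (fun f r => ∃ t ∈ Set.Ioo r (r + q), (∀ u ∈ Set.Ioo r t, A f u) ∧ B f t) :=
  (untl (.Ioo 0 q) hA hB).congr fun f r => by
    refine exists_congr fun t => ?_
    simp only [TimeInterval.toSet, Set.mem_Ioo, NNRat.cast_zero, sub_pos, and_imp,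
      sub_lt_iff_lt_add']
    tauto

theorem since_lt (q : ℚ≥0) (hA : Definable A) (hB : Definable B) :
    Definable (fun f r => ∃ t ∈ Set.Ioo (r - q) r, (∀ u ∈ Set.Ioo t r, A f u) ∧ B f t) :=
  (snce (.Ioo 0 q) hA hB).congr fun f r => by
    refine exists_congr fun t => ?_
    simp only [TimeInterval.toSet, Set.mem_Ioo, NNRat.cast_zero, sub_pos, and_imp, sub_lt_comm]
    tauto

theorem ball_lt (q : ℚ≥0) (hA : Definable A) :
    Definable (fun f r => ∀ u ∈ Set.Ioo r (r + q), A f u) :=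
  (until_lt q top hA.not).not.congr fun f r => by simp

/-- The punctual interval [q, q] reaches exactly the point at distance q. Intervals must avoid 0,
hence the separate case q = 0. -/
theorem add_nnrat (q : ℚ≥0) (hA : Definable A) : Definable (fun f r => A f (r + q)) := by
  rcases eq_or_ne q 0 with rfl | hq
  · exact hA.congr fun f r => by simp
  · have hq := pos_iff_ne_zero.2 hq
    refine (untl (.Icc q q hq) top hA).congr fun f r => ?_
    have hqr : (0 : ℝ) < q := by exact_mod_cast hq
    simp only [TimeInterval.toSet, Set.Icc_self, Set.mem_singleton_iff]
    constructor
    · rintro ⟨t, -, h, hA, -⟩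
      rwa [show r + q = t by linarith]
    · intro h
      exact ⟨r + q, by linarith, by ring, h, by simp⟩

theorem sub_nnrat (q : ℚ≥0) (hA : Definable A) : Definable (fun f r => A f (r - q)) := by
  rcases eq_or_ne q 0 with rfl | hq
  · exact hA.congr fun f r => by simp
  · have hq := pos_iff_ne_zero.2 hq
    refine (snce (.Icc q q hq) top hA).congr fun f r => ?_
    have hqr : (0 : ℝ) < q := by exact_mod_cast hq
    simp only [TimeInterval.toSet, Set.Icc_self, Set.mem_singleton_iff]
    constructor
    · rintro ⟨t, -, h, hA, -⟩
      rwa [show r - q = t by linarith]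
    · intro h
      exact ⟨r - q, by linarith, by ring, h, by simp⟩

theorem add_int (i : ℤ) (hA : Definable A) : Definable (fun f r => A f (r + i)) := by
  obtain ⟨n, rfl | rfl⟩ := i.eq_nat_or_neg
  · exact (add_nnrat n hA).congr fun f r => by simp
  · exact (sub_nnrat n hA).congr fun f r => by simp [sub_eq_add_neg]

end Definable

/-! ### Left limits and last points -/

/-- The points which are limits from the left of points where `A` holds. -/
def LeftLimit (A : Signal P → ℝ → Prop) (f : Signal P) (r : ℝ) : Prop :=
  ∀ c < r, ∃ u ∈ Set.Ioo c r, A f u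

theorem Definable.leftLimit {A : Signal P → ℝ → Prop} (hA : Definable A) :
    Definable (LeftLimit A) :=
  (strict_since hA.not top).not.congr fun f r => by simp [LeftLimit, and_assoc]

/-- The least upper bound of the points of `(a, b)` where `A` holds, if there are such points and
they do not accumulate at `b`. -/
theorem exists_last {A : Signal P → ℝ → Prop} {f : Signal P} {a b : ℝ}
    (h : ∃ u ∈ Set.Ioo a b, A f u) (hb : ¬ LeftLimit A f b) :
    ∃ s ∈ Set.Ioo a b, (A f s ∨ LeftLimit A f s) ∧ ∀ u ∈ Set.Ioo s b, ¬ A f u := by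
  obtain ⟨u₀, ⟨hau, hub⟩, hu₀⟩ := h
  simp only [LeftLimit, not_forall, not_exists, not_and] at hb
  obtain ⟨c, hc, hcA⟩ := hb
  let T := {u | u ∈ Set.Ioo a b ∧ A f u}
  have hT : u₀ ∈ T := ⟨⟨hau, hub⟩, hu₀⟩
  have hTc : ∀ u ∈ T, u ≤ c := fun u hu => by
    by_contra! hlt
    exact hcA u ⟨hlt, hu.1.2⟩ hu.2
  have hlub : IsLUB T (sSup T) := isLUB_csSup ⟨_, hT⟩ ⟨c, hTc⟩
  have h1 : u₀ ≤ sSup T := hlub.1 hT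
  have h2 : sSup T ≤ c := hlub.2 hTc
  refine ⟨sSup T, ⟨hau.trans_le h1, h2.trans_lt hc⟩, ?_, fun u hu hA => ?_⟩
  · by_cases hs : A f (sSup T)
    · exact .inl hs
    · refine .inr fun d hd => ?_
      obtain ⟨u, hu, hdu⟩ := (lt_isLUB_iff hlub).1 hd
      refine ⟨u, ⟨hdu, lt_of_le_of_ne (hlub.1 hu) ?_⟩, hu.2⟩
      rintro rfl
      exact hs hu.2
  · exact absurd (hlub.1 ⟨⟨(hau.trans_le h1).trans hu.1, hu.2⟩, hA⟩) (not_le.2 hu.1)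

/-! ### Decomposition formulas: conjunction and concatenation -/

/-- `[A, β, B]`: `A` at the left end, `β` inside the interval, `B` at the right end. -/
def segment (A β B : Signal P → ℝ → Prop) (f : Signal P) (a b : ℝ) : Prop :=
  A f a ∧ (∀ u ∈ Set.Ioo a b, β f u) ∧ B f b

/-- The relation `R` holds between the left end and some inner point `z`, the predicate `β` holds
to the right of `z`, and `B` holds at the right end. -/
def snoc (R : Signal P → ℝ → ℝ → Prop) (β B : Signal P → ℝ → Prop) (f : Signal P) (a b : ℝ) :
    Prop :=
  ∃ z ∈ Set.Ioo a b, R f a z ∧ (∀ u ∈ Set.Ioo z b, β f u) ∧ B f b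

/-- The relation `R` holds between some inner point `z` and the right end, the predicate `β` holds
to the left of `z`, and `A` holds at the left end. -/
def cons (A β : Signal P → ℝ → Prop) (R : Signal P → ℝ → ℝ → Prop) (f : Signal P) (a b : ℝ) :
    Prop :=
  ∃ z ∈ Set.Ioo a b, A f a ∧ (∀ u ∈ Set.Ioo a z, β f u) ∧ R f z b

/-- Decomposition formulas `[A₀, β₁, A₁, …, βₙ₊₁, Aₙ₊₁]` with `n` inner points, over the definable
predicates. -/
inductive Chain : ℕ → (Signal P → ℝ → ℝ → Prop) → Prop
  | segment {A β B : Signal P → ℝ → Prop} (hA : Definable A) (hβ : Definable β)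
      (hB : Definable B) : Chain 0 (segment A β B)
  | snoc {n : ℕ} {R : Signal P → ℝ → ℝ → Prop} {β B : Signal P → ℝ → Prop} (hR : Chain n R)
      (hβ : Definable β) (hB : Definable B) : Chain (n + 1) (snoc R β B)

/-- Finite unions of decomposition formulas, as relations between points `a < b`. -/
inductive Decomposable : (Signal P → ℝ → ℝ → Prop) → Prop
  | chain {n : ℕ} {R : Signal P → ℝ → ℝ → Prop} (hR : Chain n R) : Decomposable R
  | or {R S : Signal P → ℝ → ℝ → Prop} (hR : Decomposable R) (hS : Decomposable S) :
      Decomposable (fun f a b => R f a b ∨ S f a b)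
  | congr {R S : Signal P → ℝ → ℝ → Prop} (hR : Decomposable R)
      (h : ∀ f a b, a < b → (R f a b ↔ S f a b)) : Decomposable S

section

variable {R S : Signal P → ℝ → ℝ → Prop} {A B β : Signal P → ℝ → Prop}

/-- Chains are generated at the right end, which suits the induction for complements. The
translation into MTL also peels off the first gap, so chains must be extensible at the left, and
conversely readable from there. -/
theorem Chain.cons_mem {n : ℕ} (hR : Chain n R) (hA : Definable A) (hβ : Definable β) :
    Chain (n + 1) (cons A β R) := by
  induction hR with
  | @segment A' β' B' hA' hβ' hB' =>
    convert Chain.snoc (.segment hA hβ hA') hβ' hB' using 1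
    ext f a b
    simp only [MTL.cons, MTL.snoc, MTL.segment]
    exact exists_congr fun z => by tauto
  | @snoc n R β' B' hR hβ' hB' ih =>
    convert Chain.snoc ih hβ' hB' using 1
    ext f a b
    constructor
    · rintro ⟨z, ⟨h1, h2⟩, h3, h4, y, ⟨h5, h6⟩, h7⟩
      exact ⟨y, ⟨h1.trans h5, h6⟩, ⟨z, ⟨h1, h5⟩, h3, h4, h7.1⟩, h7.2⟩
    · rintro ⟨y, ⟨h5, h6⟩, ⟨z, ⟨h1, h2⟩, h3, h4, h7⟩, h8⟩
      exact ⟨z, ⟨h1, h2.trans h6⟩, h3, h4, y, ⟨h2, h6⟩, h7, h8⟩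

theorem Chain.exists_cons {n : ℕ} (hR : Chain (n + 1) R) :
    ∃ A β S, Definable A ∧ Definable β ∧ Chain n S ∧ R = MTL.cons A β S := by
  induction n generalizing R with
  | zero =>
    cases hR with
    | @snoc _ R β' B' hR hβ' hB' =>
      cases hR with
      | @segment A β B hA hβ hB =>
        refine ⟨A, β, MTL.segment B β' B', hA, hβ, .segment hB hβ' hB', ?_⟩
        ext f a b
        simp only [MTL.cons, MTL.snoc, MTL.segment]
        exact exists_congr fun z => by tauto
  | succ n ih =>
    cases hR with
    | @snoc _ R β' B' hR hβ' hB' =>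
      obtain ⟨A, β, S, hA, hβ, hS, rfl⟩ := ih hR
      refine ⟨A, β, MTL.snoc S β' B', hA, hβ, .snoc hS hβ' hB', ?_⟩
      ext f a b
      constructor
      · rintro ⟨y, ⟨h5, h6⟩, ⟨z, ⟨h1, h2⟩, h3, h4, h7⟩, h8⟩
        exact ⟨z, ⟨h1, h2.trans h6⟩, h3, h4, y, ⟨h2, h6⟩, h7, h8⟩
      · rintro ⟨z, ⟨h1, h2⟩, h3, h4, y, ⟨h5, h6⟩, h7⟩
        exact ⟨y, ⟨h1.trans h5, h6⟩, ⟨z, ⟨h1, h5⟩, h3, h4, h7.1⟩, h7.2⟩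

namespace Decomposable

theorem segment (hA : Definable A) (hβ : Definable β) (hB : Definable B) :
    Decomposable (segment A β B) := .chain (.segment hA hβ hB)

theorem left (hA : Definable A) : Decomposable (fun f a _ => A f a) :=
  (segment hA .top .top).congr fun f a b _ => by simp [MTL.segment]

theorem right (hA : Definable A) : Decomposable (fun f _ b => A f b) :=
  (segment .top .top hA).congr fun f a b _ => by simp [MTL.segment]

theorem inside (hA : Definable A) : Decomposable (fun f a b => ∀ u ∈ Set.Ioo a b, A f u) :=
  (segment .top hA .top).congr fun f a b _ => by simp [MTL.segment]

theorem const (p : Prop) : Decomposable (fun (_ : Signal P) _ _ => p) := left (.const p)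

theorem snoc (hR : Decomposable R) (hβ : Definable β) (hB : Definable B) :
    Decomposable (snoc R β B) := by
  induction hR with
  | chain hR => exact .chain (.snoc hR hβ hB)
  | or _ _ h1 h2 =>
    refine (h1.or h2).congr fun f a b _ => ?_
    simp only [MTL.snoc, ← exists_or]
    exact exists_congr fun z => by tauto
  | congr _ h h1 =>
    refine h1.congr fun f a b _ => ?_
    refine exists_congr fun z => and_congr_right fun hz => ?_
    rw [h f a z hz.1]

/-- The gap condition β has to be imposed on every gap of the chain and on its inner points as well.
The latter is why B is generalized: on the initial part the right-end condition becomes β. -/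
theorem segment_and_chain (hA : Definable A) (hβ : Definable β) (hB : Definable B) {n : ℕ}
    (hS : Chain n S) : Decomposable (fun f a b => MTL.segment A β B f a b ∧ S f a b) := by
  induction hS generalizing B with
  | segment hA' hβ' hB' =>
    refine (segment (hA.and hA') (hβ.and hβ') (hB.and hB')).congr fun f a b _ => ?_
    simp only [MTL.segment, imp_and, forall_and]
    tauto
  | snoc hS hβ' hB' ih =>
    refine ((ih hβ).snoc (hβ.and hβ') (hB.and hB')).congr fun f a b _ => ?_
    constructor
    · rintro ⟨z, hz, ⟨⟨h1, h2, h3⟩, h4⟩, h5, h6⟩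
      refine ⟨⟨h1, fun u hu => ?_, h6.1⟩, z, hz, h4, fun u hu => (h5 u hu).2, h6.2⟩
      rcases lt_trichotomy u z with h | rfl | h
      · exact h2 u ⟨hu.1, h⟩
      · exact h3
      · exact (h5 u ⟨h, hu.2⟩).1
    · rintro ⟨⟨h1, h2, h3⟩, z, hz, h4, h5, h6⟩
      exact ⟨z, hz, ⟨⟨h1, fun u hu => h2 u ⟨hu.1, hu.2.trans hz.2⟩, h2 z hz⟩, h4⟩,
        fun u hu => ⟨h2 u ⟨hz.1.trans hu.1, hu.2⟩, h5 u hu⟩, h3, h6⟩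

/-- Compare the last inner points of the two chains. If they coincide, both chains are cut there.
Otherwise cut at the later one: the chain whose last inner point comes earlier is cut inside its
last gap, so its gap condition also serves as its end condition there. -/
theorem chain_and_chain {n m : ℕ} (hR : Chain n R) (hS : Chain m S) :
    Decomposable (fun f a b => R f a b ∧ S f a b) := by
  induction hR generalizing m S with
  | segment hA hβ hB => exact segment_and_chain hA hβ hB hS
  | @snoc n R β B hR hβ hB ihR =>
    induction hS generalizing B with
    | segment hA' hβ' hB' =>
      exact (segment_and_chain hA' hβ' hB' (hR.snoc hβ hB)).congr fun f a b _ => and_comm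
    | @snoc m S β' B' hS hβ' hB' ihS =>
      refine ((((ihR hS).snoc (hβ.and hβ') (hB.and hB')).or
        ((ihR (hS.snoc hβ' hβ')).snoc (hβ.and hβ') (hB.and hB'))).or
        ((ihS hβ).snoc (hβ.and hβ') (hB.and hB'))).congr fun f a b _ => ?_
      constructor
      · rintro ((⟨z, hz, ⟨h1, h2⟩, h3, h4⟩ | ⟨z, hz, ⟨h1, y, hy, h2, h5, h6⟩, h3, h4⟩) |
          ⟨z, hz, ⟨⟨y, hy, h2, h5, h6⟩, h1⟩, h3, h4⟩)
        · exact ⟨⟨z, hz, h1, fun u hu => (h3 u hu).1, h4.1⟩,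
            ⟨z, hz, h2, fun u hu => (h3 u hu).2, h4.2⟩⟩
        · refine ⟨⟨z, hz, h1, fun u hu => (h3 u hu).1, h4.1⟩,
            ⟨y, ⟨hy.1, hy.2.trans hz.2⟩, h2, fun u hu => ?_, h4.2⟩⟩
          rcases lt_trichotomy u z with h | rfl | h
          exacts [h5 u ⟨hu.1, h⟩, h6, (h3 u ⟨h, hu.2⟩).2]
        · refine ⟨⟨y, ⟨hy.1, hy.2.trans hz.2⟩, h2, fun u hu => ?_, h4.1⟩,
            ⟨z, hz, h1, fun u hu => (h3 u hu).2, h4.2⟩⟩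
          rcases lt_trichotomy u z with h | rfl | h
          exacts [h5 u ⟨hu.1, h⟩, h6, (h3 u ⟨h, hu.2⟩).1]
      · rintro ⟨⟨z, hz, h1, h2, h3⟩, ⟨y, hy, h4, h5, h6⟩⟩
        rcases lt_trichotomy z y with h | rfl | h
        · exact .inr ⟨y, hy, ⟨⟨z, ⟨hz.1, h⟩, h1, fun u hu => h2 u ⟨hu.1, hu.2.trans hy.2⟩,
            h2 y ⟨h, hy.2⟩⟩, h4⟩, fun u hu => ⟨h2 u ⟨h.trans hu.1, hu.2⟩, h5 u hu⟩, h3, h6⟩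
        · exact .inl (.inl ⟨z, hz, ⟨h1, h4⟩, fun u hu => ⟨h2 u hu, h5 u hu⟩, h3, h6⟩)
        · exact .inl (.inr ⟨z, hz, ⟨h1, ⟨y, ⟨hy.1, h⟩, h4,
            fun u hu => h5 u ⟨hu.1, hu.2.trans hz.2⟩, h5 z ⟨h, hz.2⟩⟩⟩,
            fun u hu => ⟨h2 u hu, h5 u ⟨h.trans hu.1, hu.2⟩⟩, h3, h6⟩)

theorem and (hR : Decomposable R) (hS : Decomposable S) :
    Decomposable (fun f a b => R f a b ∧ S f a b) := by
  induction hR with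
  | chain hR =>
    induction hS with
    | chain hS => exact chain_and_chain hR hS
    | or _ _ h1 h2 => exact (h1.or h2).congr fun f a b _ => by tauto
    | congr _ h h1 => exact h1.congr fun f a b hab => by rw [h f a b hab]
  | or _ _ h1 h2 => exact (h1.or h2).congr fun f a b _ => by tauto
  | congr _ h h1 => exact h1.congr fun f a b hab => by rw [h f a b hab]

theorem concat (hR : Decomposable R) (hS : Decomposable S) :
    Decomposable (fun f a b => ∃ z ∈ Set.Ioo a b, R f a z ∧ S f z b) := by
  induction hS with
  | chain hS =>
    induction hS with
    | segment hA hβ hB =>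
      refine ((hR.and (right hA)).snoc hβ hB).congr fun f a b _ => ?_
      simp only [MTL.snoc, MTL.segment, and_assoc]
    | snoc _ hβ hB ih =>
      refine (ih.snoc hβ hB).congr fun f a b _ => ?_
      constructor
      · rintro ⟨y, hy, ⟨z, hz, h1, h2⟩, h3⟩
        exact ⟨z, ⟨hz.1, hz.2.trans hy.2⟩, h1, y, ⟨hz.2, hy.2⟩, h2, h3⟩
      · rintro ⟨z, hz, h1, y, hy, h2, h3⟩
        exact ⟨y, ⟨hz.1.trans hy.1, hy.2⟩, ⟨z, ⟨hz.1, hy.1⟩, h1, h2⟩, h3⟩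
  | or _ _ h1 h2 =>
    refine (h1.or h2).congr fun f a b _ => ?_
    simp only [← exists_or]
    exact exists_congr fun z => by tauto
  | congr _ h h1 =>
    refine h1.congr fun f a b _ => exists_congr fun z => and_congr_right fun hz => ?_
    rw [h f z b hz.2]

theorem forall_finite {ι : Type*} [Finite ι] {R : ι → Signal P → ℝ → ℝ → Prop}
    (hR : ∀ i, Decomposable (R i)) : Decomposable (fun f a b => ∀ i, R i f a b) := by
  classical
  have := Fintype.ofFinite ι
  have key : ∀ s : Finset ι, Decomposable (fun f a b => ∀ i ∈ s, R i f a b) := by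
    intro s
    induction s using Finset.induction_on with
    | empty => exact (const True).congr fun _ _ _ _ => by simp
    | insert i s _ ih => exact ((hR i).and ih).congr fun f a b _ => by simp
  exact (key Finset.univ).congr fun f a b _ => by simp

theorem exists_finite {ι : Type*} [Finite ι] {R : ι → Signal P → ℝ → ℝ → Prop}
    (hR : ∀ i, Decomposable (R i)) : Decomposable (fun f a b => ∃ i, R i f a b) := by
  classical
  have := Fintype.ofFinite ι
  have key : ∀ s : Finset ι, Decomposable (fun f a b => ∃ i ∈ s, R i f a b) := by
    intro s
    induction s using Finset.induction_on with
    | empty => exact (const False).congr fun _ _ _ _ => by simp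
    | insert i s _ ih => exact ((hR i).or ih).congr fun f a b _ => by simp
  exact (key Finset.univ).congr fun f a b _ => by simp

theorem imp_const (p : Prop) (hR : Decomposable R) : Decomposable (fun f a b => p → R f a b) :=
  ((const ¬p).or hR).congr fun _ _ _ _ => imp_iff_not_or.symm

end Decomposable

end

/-! ### Complements of decomposition formulas -/

/-- Relations with decomposable complement which grow with the right end of the interval, and
are determined by the intervals with a smaller right end. -/
structure CoDecomposable (M : Signal P → ℝ → ℝ → Prop) : Prop where
  not : Decomposable (fun f a b => ¬ M f a b)
  mono : ∀ f a b c, a < b → b ≤ c → M f a b → M f a c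
  approx : ∀ f a b, a < b → M f a b → ∃ c ∈ Set.Ioo a b, M f a c

namespace CoDecomposable

variable {M : Signal P → ℝ → ℝ → Prop} {A C : Signal P → ℝ → Prop}

theorem congr {N : Signal P → ℝ → ℝ → Prop} (hM : CoDecomposable M)
    (h : ∀ f a b, a < b → (M f a b ↔ N f a b)) : CoDecomposable N where
  not := hM.not.congr fun f a b hab => not_congr (h f a b hab)
  mono f a b c hab hbc hN :=
    (h f a c (hab.trans_le hbc)).1 (hM.mono f a b c hab hbc ((h f a b hab).2 hN))
  approx f a b hab hN := by
    obtain ⟨c, hc, hMc⟩ := hM.approx f a b hab ((h f a b hab).2 hN)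
    exact ⟨c, hc, (h f a c hc.1).1 hMc⟩

theorem left (hA : Definable A) : CoDecomposable (fun f a _ => A f a) where
  not := .left hA.not
  mono _ _ _ _ _ _ h := h
  approx _ _ _ hab h := (exists_between hab).imp fun _ hc => ⟨hc, h⟩

/-- As M grows with its right end, only the latest C-points matter. The relation fails iff there is
no C-point, or the C-points accumulate at b and M fails up to b, or M fails up to the last point s
which lies in C or is a left limit of C. At a limit, `approx` supplies a C-point slightly earlier at
which M would already hold. -/
theorem exists_and (hM : CoDecomposable M) (hC : Definable C) :
    CoDecomposable (fun f a b => ∃ z ∈ Set.Ioo a b, M f a z ∧ C f z) where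
  not := by
    refine (((Decomposable.inside hC.not).or ((Decomposable.right hC.leftLimit).and hM.not)).or
      (hM.not.concat (Decomposable.segment (hC.or hC.leftLimit) hC.not .top))).congr
      fun f a b hab => ?_
    constructor
    · rintro ((h | ⟨-, h⟩) | ⟨s, hs, h1, -, h2, -⟩) ⟨z, hz, h3, h4⟩
      · exact h z hz h4
      · exact h (hM.mono _ _ _ _ hz.1 hz.2.le h3)
      · rcases lt_or_ge s z with h | h
        · exact h2 z ⟨h, hz.2⟩ h4
        · exact h1 (hM.mono _ _ _ _ hz.1 h h3)
    · intro h
      by_cases h1 : ∃ u ∈ Set.Ioo a b, C f u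
      · have aux : ∀ s, a < s → s ≤ b → LeftLimit C f s → ¬ M f a s := by
          intro s has hsb hs hMs
          obtain ⟨c, hc, hMc⟩ := hM.approx f a s has hMs
          obtain ⟨u, hu, hCu⟩ := hs c hc.2
          exact h ⟨u, ⟨hc.1.trans hu.1, hu.2.trans_le hsb⟩,
            hM.mono _ _ _ _ hc.1 hu.1.le hMc, hCu⟩
        by_cases h2 : LeftLimit C f b
        · exact .inl (.inr ⟨h2, aux b hab le_rfl h2⟩)
        · obtain ⟨s, hs, hCs, hsb⟩ := exists_last h1 h2
          refine .inr ⟨s, hs, fun hMs => ?_, hCs, hsb, trivial⟩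
          rcases hCs with hCs | hCs
          · exact h ⟨s, hs, hMs, hCs⟩
          · exact aux s hs.1 hs.2.le hCs hMs
      · exact .inl (.inl fun u hu hCu => h1 ⟨u, hu, hCu⟩)
  mono f a b c _ hbc := fun ⟨z, hz, h⟩ => ⟨z, ⟨hz.1, hz.2.trans_le hbc⟩, h⟩
  approx f a b _ := fun ⟨z, hz, h⟩ =>
    (exists_between hz.2).imp fun c hc => ⟨⟨hz.1.trans hc.1, hc.2⟩, z, ⟨hz.1, hc.1⟩, h⟩

end CoDecomposable

/-- The right end of a decomposition formula can be quantified out, if it is only required to lie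
in the interval. -/
theorem Chain.coDecomposable {n : ℕ} {R : Signal P → ℝ → ℝ → Prop} (hR : Chain n R)
    {C : Signal P → ℝ → Prop} (hC : Definable C) :
    CoDecomposable (fun f a b => ∃ z ∈ Set.Ioo a b, R f a z ∧ C f z) := by
  induction hR generalizing C with
  | @segment A β B hA hβ hB =>
    -- The relation between the last two points is split into two unary conditions: β U (B ∧ C) at
    -- the first of them, and some later point of B ∧ C inside the interval. If the witness t of U
    -- overshoots b, then β holds up to the later point z, which becomes the witness.
    refine ((CoDecomposable.left (hA.and (hβ.strict_until (hB.and hC)))).exists_and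
      (hB.and hC)).congr fun f a b _ => ?_
    constructor
    · rintro ⟨z, hz, ⟨h1, t, ht, h2, h3⟩, h4⟩
      rcases lt_or_ge t b with h | h
      · exact ⟨t, ⟨ht, h⟩, ⟨h1, h2, h3.1⟩, h3.2⟩
      · exact ⟨z, hz, ⟨h1, fun u hu => h2 u ⟨hu.1, hu.2.trans (hz.2.trans_le h)⟩, h4.1⟩, h4.2⟩
    · rintro ⟨z, hz, ⟨h1, h2, h3⟩, h4⟩
      exact ⟨z, hz, ⟨h1, z, hz.1, h2, h3, h4⟩, h3, h4⟩
  | @snoc n R β B _ hβ hB ih =>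
    refine ((ih (hβ.strict_until (hB.and hC))).exists_and (hB.and hC)).congr fun f a b _ => ?_
    constructor
    · rintro ⟨z, hz, ⟨y, hy, h1, t, ht, h2, h3⟩, h4⟩
      rcases lt_or_ge t b with h | h
      · exact ⟨t, ⟨hy.1.trans ht, h⟩, ⟨y, ⟨hy.1, ht⟩, h1, h2, h3.1⟩, h3.2⟩
      · exact ⟨z, hz, ⟨y, hy, h1, fun u hu => h2 u ⟨hu.1, hu.2.trans (hz.2.trans_le h)⟩, h4.1⟩,
          h4.2⟩
    · rintro ⟨z, hz, ⟨y, hy, h1, h2, h3⟩, h4⟩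
      exact ⟨z, hz, ⟨y, hy, h1, z, hy.2, h2, h3, h4⟩, h3, h4⟩

/-- A decomposition formula can be split at any point of the interval. -/
theorem Chain.exists_split {n : ℕ} {R : Signal P → ℝ → ℝ → Prop} (hR : Chain n R) :
    ∃ (ι : Type) (_ : Finite ι) (S T : ι → Signal P → ℝ → ℝ → Prop),
      (∀ i, ∃ m ≤ n, Chain m (S i)) ∧ (∀ i, ∃ m ≤ n, Chain m (T i)) ∧
      ∀ f a s b, a < s → s < b → (R f a b ↔ ∃ i, S i f a s ∧ T i f s b) := by
  induction hR with
  | @segment A β B hA hβ hB =>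
    refine ⟨Unit, inferInstance, fun _ => MTL.segment A β β, fun _ => MTL.segment β β B,
      fun _ => ⟨0, le_rfl, .segment hA hβ hβ⟩, fun _ => ⟨0, le_rfl, .segment hβ hβ hB⟩,
      fun f a s b has hsb => ⟨fun ⟨h1, h2, h3⟩ => ?_, ?_⟩⟩
    · exact ⟨(), ⟨h1, fun u hu => h2 u ⟨hu.1, hu.2.trans hsb⟩, h2 s ⟨has, hsb⟩⟩,
        h2 s ⟨has, hsb⟩, fun u hu => h2 u ⟨has.trans hu.1, hu.2⟩, h3⟩
    · rintro ⟨-, ⟨h1, h2, h3⟩, h4, h5, h6⟩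
      refine ⟨h1, fun u hu => ?_, h6⟩
      rcases lt_trichotomy u s with h | rfl | h
      exacts [h2 u ⟨hu.1, h⟩, h3, h5 u ⟨h, hu.2⟩]
  | @snoc n R β B hR hβ hB ih =>
    obtain ⟨ι, _, S, T, hS, hT, h⟩ := ih
    -- The cases `none`, `some none` and `some (some i)` put the last inner point before s, at s and
    -- after s.
    refine ⟨Option (Option ι), inferInstance,
      fun o => o.elim (MTL.snoc R β β) fun o => o.elim R S,
      fun o => o.elim (MTL.segment β β B) fun o => o.elim (MTL.segment (fun _ _ => True) β B)
        fun i => MTL.snoc (T i) β B, ?_, ?_, fun f a s b has hsb => ⟨?_, ?_⟩⟩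
    · rintro (_ | _ | i)
      · exact ⟨n + 1, le_rfl, hR.snoc hβ hβ⟩
      · exact ⟨n, n.le_succ, hR⟩
      · exact (hS i).imp fun m hm => ⟨hm.1.trans n.le_succ, hm.2⟩
    · rintro (_ | _ | i)
      · exact ⟨0, Nat.zero_le _, .segment hβ hβ hB⟩
      · exact ⟨0, Nat.zero_le _, .segment .top hβ hB⟩
      · obtain ⟨m, hm, hTm⟩ := hT i
        exact ⟨m + 1, Nat.succ_le_succ hm, hTm.snoc hβ hB⟩
    · rintro ⟨z, hz, h1, h2, h3⟩
      rcases lt_trichotomy z s with hzs | rfl | hzs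
      · exact ⟨none, ⟨z, ⟨hz.1, hzs⟩, h1, fun u hu => h2 u ⟨hu.1, hu.2.trans hsb⟩,
          h2 s ⟨hzs, hsb⟩⟩, h2 s ⟨hzs, hsb⟩, fun u hu => h2 u ⟨hzs.trans hu.1, hu.2⟩, h3⟩
      · exact ⟨some none, h1, trivial, h2, h3⟩
      · obtain ⟨i, hi⟩ := (h f a s z has hzs).1 h1
        exact ⟨some (some i), hi.1, z, ⟨hzs, hz.2⟩, hi.2, h2, h3⟩
    · rintro ⟨_ | _ | i, h1, h2⟩
      · obtain ⟨z, hz, h3, h4, h5⟩ := h1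
        obtain ⟨h6, h7, h8⟩ := h2
        refine ⟨z, ⟨hz.1, hz.2.trans hsb⟩, h3, fun u hu => ?_, h8⟩
        rcases lt_trichotomy u s with h | rfl | h
        exacts [h4 u ⟨hu.1, h⟩, h6, h7 u ⟨h, hu.2⟩]
      · exact ⟨s, ⟨has, hsb⟩, h1, h2.2.1, h2.2.2⟩
      · obtain ⟨z, hz, h3, h4⟩ := h2
        exact ⟨z, ⟨has.trans hz.1, hz.2⟩, (h f a s z has hz.1).2 ⟨i, h1, h3⟩, h4⟩

/-- Suppose B holds at b. If β holds throughout, it only remains to say that no inner z has R(a, z);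
if failures of β accumulate at b, no z can work. Otherwise let s be the last failure of β, possibly
as a left limit: then z < s is impossible, z = s is excluded by ¬R(a, s), and for z > s the relation
R(a, z) splits at s into pairs Sᵢ(a, s), Tᵢ(s, z). The relations R and Sᵢ have fewer inner points,
so induction negates them; the right end z of Tᵢ is quantified out by `Chain.coDecomposable`. -/
theorem Chain.decomposable_not {n : ℕ} {R : Signal P → ℝ → ℝ → Prop} (hR : Chain n R) :
    Decomposable (fun f a b => ¬ R f a b) := by
  induction n using Nat.strong_induction_on generalizing R with
  | _ n IH =>
  cases hR with
  | @segment A β B hA hβ hB =>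
    refine (((Decomposable.left hA.not).or ((Decomposable.const True).concat
      (Decomposable.left hβ.not))).or (Decomposable.right hB.not)).congr fun f a b _ => ?_
    simp only [MTL.segment, true_and, not_and_or, not_forall, exists_prop]
    exact or_assoc
  | @snoc n R β B hR hβ hB =>
    obtain ⟨ι, _, S, T, hS, hT, h⟩ := hR.exists_split
    have hS' : ∀ i, Decomposable (fun f a b => ¬ S i f a b) := fun i => by
      obtain ⟨m, hm, hSm⟩ := hS i
      exact IH m (Nat.lt_succ_of_le hm) hSm
    have hT' : ∀ i, Decomposable (fun f a b => ¬ ∃ z ∈ Set.Ioo a b, T i f a z ∧ True) :=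
      fun i => by
        obtain ⟨m, hm, hTm⟩ := hT i
        exact (hTm.coDecomposable .top).not
    -- The set J chooses, for each way i of splitting at s, which half is refuted: the left one for
    -- i in J, the right one for the others.
    have hU : Decomposable (fun f a b => ∃ J : Set ι, ∃ s ∈ Set.Ioo a b,
        (¬ R f a s ∧ ∀ i, i ∈ J → ¬ S i f a s) ∧
        MTL.segment (fun f s => ¬ β f s ∨ LeftLimit (fun f s => ¬ β f s) f s) β (fun _ _ => True)
          f s b ∧ ∀ i, i ∉ J → ¬ ∃ z ∈ Set.Ioo s b, T i f s z ∧ True) :=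
      .exists_finite fun J =>
        ((IH n n.lt_succ_self hR).and (.forall_finite fun i => (hS' i).imp_const _)).concat
          ((Decomposable.segment (hβ.not.or hβ.not.leftLimit) hβ .top).and
            (.forall_finite fun i => (hT' i).imp_const _))
    refine ((((Decomposable.right hB.not).or
      ((Decomposable.inside hβ).and (hR.coDecomposable .top).not)).or
      (Decomposable.right hβ.not.leftLimit)).or hU).congr fun f a b hab => ?_
    constructor
    · rintro (((h1 | ⟨-, h1⟩) | h1) | ⟨J, s, hs, ⟨h1, h2⟩, ⟨h3, -, -⟩, h4⟩) ⟨z, hz, h5, h6, h7⟩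
      · exact h1 h7
      · exact h1 ⟨z, hz, h5, trivial⟩
      · obtain ⟨u, hu, hβu⟩ := h1 z hz.2
        exact hβu (h6 u hu)
      · rcases lt_trichotomy z s with hzs | rfl | hzs
        · rcases h3 with h3 | h3
          · exact h3 (h6 s ⟨hzs, hs.2⟩)
          · obtain ⟨u, hu, hβu⟩ := h3 z hzs
            exact hβu (h6 u ⟨hu.1, hu.2.trans hs.2⟩)
        · exact h1 h5
        · obtain ⟨i, hi⟩ := (h f a s z hs.1 hzs).1 h5
          by_cases hiJ : i ∈ J
          · exact h2 i hiJ hi.1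
          · exact h4 i hiJ ⟨z, ⟨hzs, hz.2⟩, hi.2, trivial⟩
    · intro hn
      by_cases hBb : B f b
      swap
      · exact .inl (.inl (.inl hBb))
      by_cases h1 : ∃ u ∈ Set.Ioo a b, ¬ β f u
      swap
      · push Not at h1
        refine .inl (.inl (.inr ⟨h1, fun ⟨z, hz, h2, _⟩ => ?_⟩))
        exact hn ⟨z, hz, h2, fun u hu => h1 u ⟨hz.1.trans hu.1, hu.2⟩, hBb⟩
      by_cases h2 : LeftLimit (fun f s => ¬ β f s) f b
      · exact .inl (.inr h2)
      obtain ⟨s, hs, hs1, hs2⟩ := exists_last (A := fun f s => ¬ β f s) h1 h2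
      simp only [not_not] at hs2
      refine .inr ⟨{i | ¬ S i f a s}, s, hs, ⟨fun h3 => hn ⟨s, hs, h3, hs2, hBb⟩, fun i hi => hi⟩,
        ⟨hs1, hs2, trivial⟩, ?_⟩
      rintro i hi ⟨z, hz, h3, -⟩
      simp only [Set.mem_ofPred_eq, not_not] at hi
      exact hn ⟨z, ⟨hs.1.trans hz.1, hz.2⟩, (h f a s z hs.1 hz.1).2 ⟨i, hi, h3⟩,
        fun u hu => hs2 u ⟨hz.1.trans hu.1, hu.2⟩, hBb⟩

theorem Decomposable.not {R : Signal P → ℝ → ℝ → Prop} (hR : Decomposable R) :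
    Decomposable (fun f a b => ¬ R f a b) := by
  induction hR with
  | chain hR => exact hR.decomposable_not
  | or _ _ h1 h2 => exact (h1.and h2).congr fun f a b _ => not_or.symm
  | congr _ h h1 => exact h1.congr fun f a b hab => not_congr (h f a b hab)

/-! ### Decomposition formulas over intervals of fixed length -/

/-- Let `T` be a decomposition formula without condition at the left end, whose first interval
carries the predicate `γ`. Then `T` can be extended to the left along `γ`; it splits at a point `s`
either within the first interval or into formulas of which the second is shorter; and `K` is the
formula which is obtained by removing the first interval and appending one that carries `β`. -/
structure HeadData (n : ℕ) (γ : Signal P → ℝ → Prop) (T : Signal P → ℝ → ℝ → Prop) : Prop where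
  chain : Chain n T
  definable : Definable γ
  extend : ∀ f a s b, a < s → s < b → (∀ u ∈ Set.Ioc a s, γ f u) → T f s b → T f a b
  split : ∃ (ι : Type) (_ : Finite ι) (R₁ R₂ : ι → Signal P → ℝ → ℝ → Prop),
    (∀ i, ∃ m ≤ n, Chain m (R₁ i)) ∧ (∀ i, ∃ m < n, Chain m (R₂ i)) ∧
    ∀ f a s b, a < s → s < b → (T f a b ↔
      ((∀ u ∈ Set.Ioc a s, γ f u) ∧ T f s b) ∨ ∃ i, R₁ i f a s ∧ R₂ i f s b)
  tail : ∀ β, Definable β → ∃ K : Signal P → ℝ → ℝ → Prop, Chain n K ∧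
    (∀ f a z, a < z → T f a z → ∃ y ∈ Set.Ioc a z, (∀ u ∈ Set.Ioo a y, γ f u) ∧
      ∀ c > z, (∀ u ∈ Set.Ioo z c, β f u) → K f y c) ∧
    (∀ f a y c, a < y → y < c → (∀ u ∈ Set.Ioo a y, γ f u) → K f y c →
      ∃ z ∈ Set.Ico y c, T f a z ∧ ∀ u ∈ Set.Ioo z c, β f u)

theorem headData_segment {γ C : Signal P → ℝ → Prop} (hγ : Definable γ) (hC : Definable C) :
    HeadData 0 γ (segment (fun _ _ => True) γ C) where
  chain := .segment .top hγ hC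
  definable := hγ
  extend f a s b has hsb h := by
    rintro ⟨-, h1, h2⟩
    exact ⟨trivial, fun u hu => (le_or_gt u s).elim (fun h3 => h u ⟨hu.1, h3⟩)
      fun h3 => h1 u ⟨h3, hu.2⟩, h2⟩
  split := by
    refine ⟨Empty, inferInstance, Empty.elim, Empty.elim, Empty.rec, Empty.rec,
      fun f a s b has hsb => ?_⟩
    simp only [segment, IsEmpty.exists_iff, or_false, true_and]
    constructor
    · rintro ⟨h1, h2⟩
      exact ⟨fun u hu => h1 u ⟨hu.1, hu.2.trans_lt hsb⟩, fun u hu => h1 u ⟨has.trans hu.1, hu.2⟩,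
        h2⟩
    · rintro ⟨h, h1, h2⟩
      exact ⟨fun u hu => (le_or_gt u s).elim (fun h3 => h u ⟨hu.1, h3⟩)
        fun h3 => h1 u ⟨h3, hu.2⟩, h2⟩
  tail β hβ := by
    refine ⟨segment C β fun _ _ => True, .segment hC hβ .top, ?_, ?_⟩
    · rintro f a z haz ⟨-, h1, h2⟩
      exact ⟨z, ⟨haz, le_rfl⟩, h1, fun c _ h => ⟨h2, h, trivial⟩⟩
    · rintro f a y c _ hyc h ⟨h1, h2, -⟩
      exact ⟨y, ⟨le_rfl, hyc⟩, ⟨trivial, h, h1⟩, h2⟩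

/-- Everything depends on the position of the first inner point relative to s. If it is after s,
then γ holds on (a, s]; if it is at or before s, the part to the right of s has lost at least one
inner point, whence the strict bound. -/
theorem headData_cons {n : ℕ} {γ : Signal P → ℝ → Prop} {S : Signal P → ℝ → ℝ → Prop}
    (hγ : Definable γ) (hS : Chain n S) :
    HeadData (n + 1) γ (cons (fun _ _ => True) γ S) where
  chain := hS.cons_mem .top hγ
  definable := hγ
  extend f a s b has hsb h := by
    rintro ⟨z, hz, -, h1, h2⟩
    exact ⟨z, ⟨has.trans hz.1, hz.2⟩, trivial, fun u hu => (le_or_gt u s).elim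
      (fun h3 => h u ⟨hu.1, h3⟩) fun h3 => h1 u ⟨h3, hu.2⟩, h2⟩
  split := by
    obtain ⟨ι, _, R₁, R₂, h₁, h₂, h⟩ := hS.exists_split
    refine ⟨Option ι, inferInstance,
      fun o => o.elim (segment (fun _ _ => True) γ fun _ _ => True)
        fun i => cons (fun _ _ => True) γ (R₁ i), fun o => o.elim S R₂, ?_, ?_,
      fun f a s b has hsb => ⟨?_, ?_⟩⟩
    · rintro (_ | i)
      · exact ⟨0, Nat.zero_le _, .segment .top hγ .top⟩
      · obtain ⟨m, hm, hc⟩ := h₁ i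
        exact ⟨m + 1, Nat.succ_le_succ hm, hc.cons_mem .top hγ⟩
    · rintro (_ | i)
      · exact ⟨n, n.lt_succ_self, hS⟩
      · exact (h₂ i).imp fun m hm => ⟨Nat.lt_succ_of_le hm.1, hm.2⟩
    · rintro ⟨z, hz, -, h1, h2⟩
      rcases lt_trichotomy z s with hzs | rfl | hzs
      · obtain ⟨i, hi⟩ := (h f z s b hzs hsb).1 h2
        exact .inr ⟨some i, ⟨z, ⟨hz.1, hzs⟩, trivial, h1, hi.1⟩, hi.2⟩
      · exact .inr ⟨none, ⟨trivial, h1, trivial⟩, h2⟩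
      · exact .inl ⟨fun u hu => h1 u ⟨hu.1, hu.2.trans_lt hzs⟩, z, ⟨hzs, hz.2⟩, trivial,
          fun u hu => h1 u ⟨has.trans hu.1, hu.2⟩, h2⟩
    · rintro (⟨h0, z, hz, -, h1, h2⟩ | ⟨_ | i, h1, h2⟩)
      · exact ⟨z, ⟨has.trans hz.1, hz.2⟩, trivial, fun u hu => (le_or_gt u s).elim
          (fun h3 => h0 u ⟨hu.1, h3⟩) fun h3 => h1 u ⟨h3, hu.2⟩, h2⟩
      · exact ⟨s, ⟨has, hsb⟩, trivial, h1.2.1, h2⟩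
      · obtain ⟨z, hz, -, h3, h4⟩ := h1
        exact ⟨z, ⟨hz.1, hz.2.trans hsb⟩, trivial, h3, (h f z s b hz.2 hsb).2 ⟨i, h4, h2⟩⟩
  tail β hβ := by
    refine ⟨snoc S β fun _ _ => True, hS.snoc hβ .top, ?_, ?_⟩
    · rintro f a z - ⟨y, hy, -, h1, h2⟩
      exact ⟨y, ⟨hy.1, hy.2.le⟩, h1, fun c hc h => ⟨z, ⟨hy.2, hc⟩, h2, h, trivial⟩⟩
    · rintro f a y c hay - h ⟨z, hz, h1, h2, -⟩
      exact ⟨z, ⟨hz.1.le, hz.2⟩, ⟨y, ⟨hay, hz.1⟩, trivial, h, h1⟩, h2⟩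

theorem Chain.exists_headData {n : ℕ} {R : Signal P → ℝ → ℝ → Prop} (hR : Chain n R) :
    ∃ A γ T, Definable A ∧ HeadData n γ T ∧ ∀ f a b, R f a b ↔ A f a ∧ T f a b := by
  cases n with
  | zero =>
    cases hR with
    | @segment A γ C hA hγ hC =>
      exact ⟨A, γ, _, hA, headData_segment hγ hC, fun f a b => by simp [MTL.segment]⟩
  | succ n =>
    obtain ⟨A, γ, S, hA, hγ, hS, rfl⟩ := hR.exists_cons
    refine ⟨A, γ, _, hA, headData_cons hγ hS, fun f a b => ?_⟩
    simp only [MTL.cons, true_and, ← exists_and_left]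
    exact exists_congr fun z => by tauto

/-- A decomposition formula over the interval from `r` to `r + q` is an MTL formula at `r`. If all
inner points lie in the same open half of the interval, they are reached with `U` or `S` restricted
to that half, and otherwise the formula splits into shorter ones. -/
theorem Chain.definable {n : ℕ} {R : Signal P → ℝ → ℝ → Prop} (hR : Chain n R) {q : ℚ≥0}
    (hq : 0 < q) : Definable (fun f r => R f r (r + q)) := by
  induction n using Nat.strong_induction_on generalizing R q with
  | _ n IH =>
  have hq2 : 0 < q / 2 := half_pos hq
  have hp0 : (0 : ℝ) < ((q / 2 : ℚ≥0) : ℝ) := by exact_mod_cast hq2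
  have hqq : (q : ℝ) = ((q / 2 : ℚ≥0) : ℝ) + ((q / 2 : ℚ≥0) : ℝ) := by push_cast; ring
  generalize q / 2 = p at *
  have hsplit : ∀ {R₁ R₂ : Signal P → ℝ → ℝ → Prop}, (∃ m < n, Chain m R₁) →
      (∃ m < n, Chain m R₂) → Definable (fun f r => R₁ f r (r + p) ∧
        R₂ f (r + p) (r + p + p)) := by
    rintro R₁ R₂ ⟨m₁, hm₁, h₁⟩ ⟨m₂, hm₂, h₂⟩
    exact (IH m₁ hm₁ h₁ hq2).and ((IH m₂ hm₂ h₂ hq2).add_nnrat p)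
  cases hR with
  | @segment A β B hA hβ hB => exact hA.and ((hβ.ball_lt q).and (hB.add_nnrat q))
  | @snoc n R β B hR hβ hB =>
    obtain ⟨A, γ, T, hA, hT, hRT⟩ := hR.exists_headData
    obtain ⟨ι, _, R₁, R₂, hR₁, hR₂, hι⟩ := hT.split
    obtain ⟨K, hK, hK₁, hK₂⟩ := hT.tail β hβ
    -- Below, s = r + p is the midpoint, b = s + p, and z is the last inner point of the whole
    -- chain. Here z < s. Let y be the end of the first gap: the rest of the chain is seen in the
    -- window (y, y + p), which contains no point beyond b, and whose unused end is filled by the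
    -- last gap condition β. So K at y has fixed length p and one inner point fewer than the whole.
    have h₁ := (hA.and (hT.definable.until_lt p (IH n n.lt_succ_self hK hq2))).and
      ((hβ.and ((hβ.ball_lt p).and (hB.add_nnrat p))).add_nnrat p)
    -- The mirror case: γ covers (r, s] and z > s. The chain up to z is seen in the window (z - p,
    -- z), which starts inside (r, s); there the first gap can be lengthened or shortened along γ.
    have h₂ := (hA.and ((hT.definable.ball_lt p).and (hT.definable.add_nnrat p))).and
      (((hβ.since_lt p ((IH n n.lt_succ_self hT.chain hq2).sub_nnrat p)).and
        hB).add_nnrat p |>.add_nnrat p)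
    have h₃ := hsplit ⟨n, n.lt_succ_self, hR⟩ ⟨0, n.succ_pos, .segment .top hβ hB⟩
    -- Here z > s but the first gap ends by s. Both halves have fewer inner points than the whole:
    -- the strict bound on `R₂ i` makes room for z.
    have h₄ := hA.and (Definable.exists_finite fun i : ι => hsplit
      ((hR₁ i).imp fun m hm => ⟨Nat.lt_succ_of_le hm.1, hm.2⟩)
      (R₂ := MTL.snoc (R₂ i) β B) (by
        obtain ⟨m, hm, hc⟩ := hR₂ i
        exact ⟨m + 1, Nat.succ_lt_succ hm, hc.snoc hβ hB⟩))
    refine (((h₁.or h₂).or h₃).or h₄).congr fun f r => ?_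
    rw [hqq, ← add_assoc]
    clear h₁ h₂ h₃ h₄ hsplit IH
    generalize hs : r + (p : ℝ) = s
    generalize hb : s + (p : ℝ) = b
    have hrs : r < s := by linarith
    have hsb : s < b := by linarith
    constructor
    · rintro (((⟨⟨h1, y, hy, h2, h3⟩, h4, h5, h6⟩ | ⟨⟨h1, h2, h3⟩, ⟨z, hz, h4, h5⟩, h6⟩) |
        ⟨h1, -, h2, h3⟩) | ⟨h1, i, h2, z, hz, h3, h4⟩)
      -- The point z may lie beyond s, but it is below y + p < b, and β at s and on (s, b) still
      -- completes the last gap.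
      · obtain ⟨z, hz, h7, h8⟩ := hK₂ f r y (y + p) hy.1 (by linarith) h2 h3
        refine ⟨z, ⟨hy.1.trans_le hz.1, by linarith [hz.2, hy.2]⟩, (hRT _ _ _).2 ⟨h1, h7⟩,
          fun u hu => ?_, h6⟩
        rcases lt_trichotomy u s with h | rfl | h
        exacts [h8 u ⟨hu.1, by linarith [hy.1]⟩, h4, h5 u ⟨h, hu.2⟩]
      · rw [sub_add_cancel] at h5
        have hzs : s < z := by linarith [hz.1]
        refine ⟨z, ⟨hrs.trans hzs, hz.2⟩, (hRT _ _ _).2 ⟨h1, ?_⟩, h4, h6⟩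
        refine hT.extend f r (z - p) z (by linarith) (by linarith) (fun u hu => ?_) h5
        exact h2 u ⟨hu.1, by linarith [hu.2, hz.2]⟩
      · exact ⟨s, ⟨hrs, hsb⟩, h1, h2, h3⟩
      · exact ⟨z, ⟨hrs.trans hz.1, hz.2⟩,
          (hRT _ _ _).2 ⟨h1, (hι f r s z hrs hz.1).2 (.inr ⟨i, h2, h3⟩)⟩, h4⟩
    · rintro ⟨z, hz, h1, h2, h3⟩
      obtain ⟨h4, h5⟩ := (hRT _ _ _).1 h1
      rcases lt_trichotomy z s with hzs | rfl | hzs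
      · obtain ⟨y, hy, h6, h7⟩ := hK₁ f r z hz.1 h5
        refine .inl (.inl (.inl ⟨⟨h4, y, ⟨hy.1, hy.2.trans_lt hzs⟩, h6, ?_⟩, ?_⟩))
        · exact h7 (y + p) (by linarith [hy.1]) fun u hu => h2 u ⟨hu.1, by linarith [hu.2, hy.2]⟩
        · exact ⟨h2 s ⟨hzs, hsb⟩, fun u hu => h2 u ⟨hzs.trans hu.1, hu.2⟩, h3⟩
      · exact .inl (.inr ⟨h1, trivial, h2, h3⟩)
      · rcases (hι f r s z hrs hzs).1 h5 with ⟨h6, h7⟩ | ⟨i, h6, h7⟩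
        · refine .inl (.inl (.inr ⟨⟨h4, fun u hu => h6 u ⟨hu.1, hu.2.le⟩, h6 s ⟨hrs, le_rfl⟩⟩,
            ⟨z, ⟨by linarith, hz.2⟩, h2, ?_⟩, h3⟩))
          rw [sub_add_cancel]
          exact hT.extend f (z - p) s z (by linarith [hz.2]) hzs
            (fun u hu => h6 u ⟨by linarith [hu.1], hu.2⟩) h7
        · exact .inr ⟨h4, i, h6, z, ⟨hzs, hz.2⟩, h7, h2, h3⟩

theorem Decomposable.definable {R : Signal P → ℝ → ℝ → Prop} (hR : Decomposable R) {q : ℚ≥0}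
    (hq : 0 < q) : Definable (fun f r => R f r (r + q)) := by
  induction hR with
  | chain hR => exact hR.definable hq
  | or _ _ h1 h2 => exact h1.or h2
  | congr _ h h1 => exact h1.congr fun f r => h f r _ (by simpa using hq)

-- Types of labelled intervals and the back-and-forth argument

universe u


/-- The types of depth `k` of intervals whose points are labelled with sets of elements of `Q`. -/
def IntervalType (Q : Type u) : ℕ → Type u
  | 0 => PUnit
  | k + 1 => Set (IntervalType Q k × Set Q × IntervalType Q k)

instance IntervalType.instFinite (Q : Type*) [Finite Q] (k : ℕ) : Finite (IntervalType Q k) := by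
  induction k with
  | zero => exact inferInstanceAs (Finite PUnit)
  | succ k ih => exact inferInstanceAs (Finite (Set (IntervalType Q k × Set Q × IntervalType Q k)))

/-- The type of depth `k` of the interval `(a, b)`. -/
def intervalType {Q : Type*} (l : ℝ → Set Q) : (k : ℕ) → ℝ → ℝ → IntervalType Q k
  | 0, _, _ => PUnit.unit
  | k + 1, a, b => {e | ∃ c ∈ Set.Ioo a b, (intervalType l k a c, l c, intervalType l k c b) = e}

/-- The triples of labels and types of depth `k` to which the points of `(a, b)` give rise. -/
def splitTypes {Q : Type*} (l : ℝ → Set Q) (k : ℕ) (a b : ℝ) :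
    Set (IntervalType Q k × Set Q × IntervalType Q k) :=
  {e | ∃ c ∈ Set.Ioo a b, (intervalType l k a c, l c, intervalType l k c b) = e}

theorem splitTypes_eq {Q : Type*} {l l' : ℝ → Set Q} {k : ℕ} {a b a' b' : ℝ}
    (h : intervalType l (k + 1) a b = intervalType l' (k + 1) a' b') :
    splitTypes l k a b = splitTypes l' k a' b' := h

theorem intervalType_lower {Q : Type*} {l l' : ℝ → Set Q} {k : ℕ} {a b a' b' : ℝ}
    (h : intervalType l (k + 1) a b = intervalType l' (k + 1) a' b') :
    intervalType l k a b = intervalType l' k a' b' := by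
  induction k generalizing a b a' b' with
  | zero => rfl
  | succ k ih =>
    have key : ∀ {l l' : ℝ → Set Q} {a b a' b' : ℝ},
        (∀ {a b a' b' : ℝ}, intervalType l (k + 1) a b = intervalType l' (k + 1) a' b' →
          intervalType l k a b = intervalType l' k a' b') →
        intervalType l (k + 2) a b = intervalType l' (k + 2) a' b' →
        ∀ e ∈ splitTypes l k a b, e ∈ splitTypes l' k a' b' := by
      rintro l l' a b a' b' ih h e ⟨c, hc, rfl⟩
      have hmem : (intervalType l (k + 1) a c, l c, intervalType l (k + 1) c b) ∈
        splitTypes l (k + 1) a b := ⟨c, hc, rfl⟩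
      rw [splitTypes_eq h] at hmem
      obtain ⟨c', hc', he⟩ := hmem
      simp only [Prod.mk.injEq] at he
      refine ⟨c', hc', ?_⟩
      rw [← he.2.1, ih he.1.symm, ih he.2.2.symm]
    exact Set.Subset.antisymm (key ih h) (key (fun h => (ih h.symm).symm) h.symm)

theorem Definable.label_eq {Q : Type*} [Finite Q] {l : Signal P → ℝ → Set Q}
    (hl : ∀ x, Definable (fun f r => x ∈ l f r)) (σ : Set Q) :
    Definable (fun f r => l f r = σ) := by
  refine (Definable.forall_finite fun x => ?_ :
    Definable fun f r => ∀ x, x ∈ l f r ↔ x ∈ σ).congr fun f r => Set.ext_iff.symm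
  by_cases hx : x ∈ σ
  · exact (hl x).congr fun f r => by simp [hx]
  · exact (hl x).not.congr fun f r => by simp [hx]

/-- A type of depth k + 1 lists which of finitely many triples (type, label, type) are realized by
inner points. Realizing a triple is a concatenation; not realizing it is the reason why complements
are needed. -/
theorem Decomposable.intervalType_eq {Q : Type*} [Finite Q] {l : Signal P → ℝ → Set Q}
    (hl : ∀ x, Definable (fun f r => x ∈ l f r)) (k : ℕ) (τ : IntervalType Q k) :
    Decomposable (fun f a b => intervalType (l f) k a b = τ) := by
  induction k with
  | zero => exact (const True).congr fun _ _ _ _ =>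
      iff_of_true trivial (Subsingleton.elim (α := PUnit) _ _)
  | succ k ih =>
    change Set (IntervalType Q k × Set Q × IntervalType Q k) at τ
    have hmem : ∀ e : IntervalType Q k × Set Q × IntervalType Q k,
        Decomposable (fun f a b => e ∈ splitTypes (l f) k a b) := by
      rintro ⟨τ₁, σ, τ₂⟩
      refine (((ih τ₁).and (right (Definable.label_eq hl σ))).concat (ih τ₂)).congr
        fun f a b _ => ?_
      refine exists_congr fun c => and_congr_right fun _ => ?_
      simp [and_assoc]
    refine (Decomposable.forall_finite fun e => ?_ : Decomposable fun f a b =>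
      ∀ e, e ∈ splitTypes (l f) k a b ↔ e ∈ τ).congr fun f a b _ => Set.ext_iff.symm
    by_cases he : e ∈ τ
    · exact (hmem e).congr fun f a b _ => by simp [he]
    · exact (hmem e).not.congr fun f a b _ => by simp [he]

/-- Finite partial isomorphisms between the intervals `(a, b)` and `(a', b')`, such that
corresponding gaps have equal types of depth `k`. -/
inductive Match {Q : Type*} (l l' : ℝ → Set Q) (k : ℕ) :
    ℝ → ℝ → ℝ → ℝ → (ℝ → ℝ → Prop) → Prop
  | leaf {a b a' b' : ℝ} (hab : a < b) (hab' : a' < b')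
      (h : intervalType l k a b = intervalType l' k a' b') :
      Match l l' k a b a' b' (fun _ _ => False)
  | node {a b a' b' c c' : ℝ} {M N : ℝ → ℝ → Prop} (hM : Match l l' k a c a' c' M)
      (hN : Match l l' k c b c' b' N) (h : l c = l' c') :
      Match l l' k a b a' b' (fun p p' => M p p' ∨ (p = c ∧ p' = c') ∨ N p p')

namespace Match

variable {Q : Type*} {l l' : ℝ → Set Q} {k : ℕ} {a b a' b' : ℝ} {M : ℝ → ℝ → Prop}

theorem symm (h : Match l l' k a b a' b' M) : Match l' l k a' b' a b (fun p' p => M p p') := by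
  induction h with
  | leaf hab hab' h => exact .leaf hab' hab h.symm
  | node _ _ h h1 h2 =>
    convert Match.node h1 h2 h.symm using 5
    rw [and_comm]

theorem lower (h : Match l l' (k + 1) a b a' b' M) : Match l l' k a b a' b' M := by
  induction h with
  | leaf hab hab' h => exact .leaf hab hab' (intervalType_lower h)
  | node _ _ h h1 h2 => exact .node h1 h2 h

theorem mono {m : ℕ} (hkm : k ≤ m) (h : Match l l' m a b a' b' M) : Match l l' k a b a' b' M := by
  induction m, hkm using Nat.le_induction with
  | base => exact h
  | succ m _ ih => exact ih h.lower

theorem lt (h : Match l l' k a b a' b' M) : a < b ∧ a' < b' := by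
  induction h with
  | leaf hab hab' => exact ⟨hab, hab'⟩
  | node _ _ _ h1 h2 => exact ⟨h1.1.trans h2.1, h1.2.trans h2.2⟩

theorem mem_Ioo (h : Match l l' k a b a' b' M) {p p' : ℝ} (hp : M p p') :
    p ∈ Set.Ioo a b ∧ p' ∈ Set.Ioo a' b' := by
  induction h with
  | leaf => exact hp.elim
  | node hM hN _ h1 h2 =>
    have h3 := hM.lt
    have h4 := hN.lt
    rcases hp with hp | ⟨rfl, rfl⟩ | hp
    · have := h1 hp
      exact ⟨⟨this.1.1, this.1.2.trans h4.1⟩, this.2.1, this.2.2.trans h4.2⟩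
    · exact ⟨⟨h3.1, h4.1⟩, h3.2, h4.2⟩
    · have := h2 hp
      exact ⟨⟨h3.1.trans this.1.1, this.1.2⟩, h3.2.trans this.2.1, this.2.2⟩

theorem label_eq (h : Match l l' k a b a' b' M) {p p' : ℝ} (hp : M p p') : l p = l' p' := by
  induction h with
  | leaf => exact hp.elim
  | node _ _ h h1 h2 =>
    rcases hp with hp | ⟨rfl, rfl⟩ | hp
    exacts [h1 hp, h, h2 hp]

theorem lt_of_lt (h : Match l l' k a b a' b' M) {p p' r r' : ℝ} (hp : M p p') (hr : M r r')
    (hpr : p < r) : p' < r' := by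
  induction h with
  | leaf => exact hp.elim
  | node hM hN _ h1 h2 =>
    rcases hp with hp | ⟨rfl, rfl⟩ | hp <;> rcases hr with hr | ⟨rfl, rfl⟩ | hr
    · exact h1 hp hr
    · exact (hM.mem_Ioo hp).2.2
    · exact (hM.mem_Ioo hp).2.2.trans (hN.mem_Ioo hr).2.1
    · exact absurd hpr (hM.mem_Ioo hr).1.2.not_gt
    · exact absurd hpr (lt_irrefl _)
    · exact (hN.mem_Ioo hr).2.1
    · exact absurd hpr ((hM.mem_Ioo hr).1.2.trans (hN.mem_Ioo hp).1.1).not_gt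
    · exact absurd hpr (hN.mem_Ioo hp).1.1.not_gt
    · exact h2 hp hr

/-- A point that is not yet matched lies in one gap, and equality of the types of depth k + 1 there
provides a partner leaving equal types of depth k on both sides. All other gaps just lose one level
of depth. -/
theorem exists_extend (h : Match l l' (k + 1) a b a' b' M) {c : ℝ} (hc : c ∈ Set.Ioo a b) :
    ∃ c' N, Match l l' k a b a' b' N ∧ (∀ p p', M p p' → N p p') ∧ N c c' := by
  induction h with
  | @leaf a b a' b' hab hab' h =>
    have hmem : (intervalType l k a c, l c, intervalType l k c b) ∈ splitTypes l k a b :=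
      ⟨c, hc, rfl⟩
    rw [splitTypes_eq h] at hmem
    obtain ⟨c', hc', he⟩ := hmem
    simp only [Prod.mk.injEq] at he
    exact ⟨c', _, .node (.leaf hc.1 hc'.1 he.1.symm) (.leaf hc.2 hc'.2 he.2.2.symm) he.2.1.symm,
      fun _ _ h => h.elim, .inr (.inl ⟨rfl, rfl⟩)⟩
  | @node a b a' b' d d' M₁ M₂ hM hN h h1 h2 =>
    rcases lt_trichotomy c d with hcd | rfl | hcd
    · obtain ⟨c', N, h3, h4, h5⟩ := h1 ⟨hc.1, hcd⟩
      exact ⟨c', _, .node h3 hN.lower h, fun p p' => Or.imp_left (h4 p p'), .inl h5⟩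
    · exact ⟨d', _, .node hM.lower hN.lower h, fun _ _ h => h, .inr (.inl ⟨rfl, rfl⟩)⟩
    · obtain ⟨c', N, h3, h4, h5⟩ := h2 ⟨hcd, hc.2⟩
      exact ⟨c', _, .node hM.lower h3 h, fun p p' => Or.imp_right (Or.imp_right (h4 p p')),
        .inr (.inr h5)⟩

end Match

end MTL

/-! ### Folding bounded formulas onto the unit interval -/

namespace FOOne

variable {P : Type*}

/-- The number of applications of `+1` in a term. -/
def Term.shift : Term → ℕ
  | .var _ => 0
  | .succ t => t.shift + 1

/-- The variable of a term. -/
def Term.head : Term → ℕ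
  | .var x => x
  | .succ t => t.head

theorem Term.eval_eq (v : ℕ → ℝ) (t : Term) : t.eval v = v t.head + t.shift := by
  induction t with
  | var x => simp [Term.eval, Term.head, Term.shift]
  | succ t ih => simp only [Term.eval, Term.head, Term.shift, ih]; push_cast; ring

theorem Term.head_mem_vars (t : Term) : t.head ∈ t.vars := by
  induction t with
  | var x => exact rfl
  | succ t ih => exact ih

theorem Term.eval_addNat (v : ℕ → ℝ) (t : Term) (n : ℕ) :
    (t.addNat n).eval v = t.eval v + n := by
  induction n with
  | zero => simp [Term.addNat]
  | succ n ih => simp only [Term.addNat, Term.eval, ih]; push_cast; ring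

theorem Formula.sat_between (f : Signal P) (v : ℕ → ℝ) (N x z : ℕ) :
    (Formula.between N x z : Formula P).Sat f v ↔ v z ∈ Set.Ico (v x - N) (v x + N) := by
  simp [Formula.between, Formula.Sat, Term.eval_addNat, Term.eval]

/-- The predicates which occur in a formula. -/
def Formula.preds : Formula P → Set P
  | .tru => ∅
  | .pred p _ => {p}
  | .lt _ _ => ∅
  | .and φ ψ => φ.preds ∪ ψ.preds
  | .neg φ => φ.preds
  | .ex _ φ => φ.preds

theorem Formula.finite_preds (φ : Formula P) : φ.preds.Finite := by
  induction φ with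
  | tru => exact Set.finite_empty
  | pred p t => exact Set.finite_singleton p
  | lt s t => exact Set.finite_empty
  | and φ ψ h1 h2 => exact h1.union h2
  | neg φ h => exact h
  | ex x φ h => exact h

/-- The predicates from `S` which hold at the points `r + i` for `-N ≤ i < N`. -/
def label (S : Set P) (N : ℕ) (f : Signal P) (r : ℝ) : Set (S × Set.Ico (-N : ℤ) N) :=
  {x | (x.1 : P) ∈ f (r + ((x.2 : ℤ) : ℝ))}

/-- The assignments `v` and `v'` give to `y` values with the same integral distance to
corresponding points of `[r, r + 1)` and `[r', r' + 1)`. -/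
def Corresponds (M : ℝ → ℝ → Prop) (r r' : ℝ) (N : ℕ) (v v' : ℕ → ℝ) (y : ℕ) : Prop :=
  ∃ p p' : ℝ, ∃ i : Set.Ico (-N : ℤ) N, ((p = r ∧ p' = r') ∨ M p p') ∧
    v y = p + ((i : ℤ) : ℝ) ∧ v' y = p' + ((i : ℤ) : ℝ)

end FOOne

open MTL in
-- The base points lie in half-open intervals of length 1, so distinct integer shifts decide the
-- order on both sides alike; for equal shifts the matching preserves it.
theorem FOOne.add_int_lt_add_int {Q : Type*} {l l' : ℝ → Set Q} {k : ℕ} {r r' : ℝ}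
    {M : ℝ → ℝ → Prop} (hM : Match l l' k r (r + 1) r' (r' + 1) M) {p p' s s' : ℝ} {i j : ℤ}
    (hp : (p = r ∧ p' = r') ∨ M p p') (hs : (s = r ∧ s' = r') ∨ M s s') (h : p + i < s + j) :
    p' + i < s' + j := by
  have aux : ∀ {p p'}, (p = r ∧ p' = r') ∨ M p p' →
      (r ≤ p ∧ p < r + 1) ∧ (r' ≤ p' ∧ p' < r' + 1) := by
    rintro p p' (⟨rfl, rfl⟩ | h)
    · simp
    · have := hM.mem_Ioo h
      exact ⟨⟨this.1.1.le, this.1.2⟩, this.2.1.le, this.2.2⟩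
  have hp' := aux hp
  have hs' := aux hs
  rcases lt_trichotomy i j with hij | rfl | hij
  · have : (i : ℝ) + 1 ≤ j := by exact_mod_cast hij
    linarith
  · have hlt : p < s := by linarith
    have : p' < s' := by
      rcases hp with ⟨rfl, rfl⟩ | hp <;> rcases hs with ⟨rfl, rfl⟩ | hs
      · exact absurd hlt (lt_irrefl _)
      · exact (hM.mem_Ioo hs).2.1
      · exact absurd hlt (not_lt.2 hp'.1.1)
      · exact hM.lt_of_lt hp hs hlt
    linarith
  · have : (j : ℝ) + 1 ≤ i := by exact_mod_cast hij
    linarith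

namespace FOOne

open MTL

variable {P : Type*}

/-- A bounded formula cannot distinguish assignments of corresponding points. -/
theorem Formula.InBet.exists_depth {N x : ℕ} {B : Set ℕ} {φ : Formula P} (hφ : φ.InBet N x B)
    {S : Set P} (hS : φ.preds ⊆ S) (hfree : φ.freeVars ⊆ insert x B) :
    ∃ k : ℕ, ∀ (f f' : Signal P) (v v' : ℕ → ℝ) (M : ℝ → ℝ → Prop),
      Match (label S N f) (label S N f') k (v x) (v x + 1) (v' x) (v' x + 1) M →
      label S N f (v x) = label S N f' (v' x) →
      (∀ y ∈ B, Corresponds M (v x) (v' x) N v v' y) → (φ.Sat f v ↔ φ.Sat f' v') := by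
  induction hφ with
  | tru B => exact ⟨0, fun _ _ _ _ _ _ _ _ => Iff.rfl⟩
  | pred B p y hy =>
    refine ⟨0, fun f f' v v' M hM hl hB => ?_⟩
    obtain ⟨q, q', i, hq, h1, h2⟩ := hB y hy
    have hlq : label S N f q = label S N f' q' := by
      rcases hq with ⟨rfl, rfl⟩ | hq
      exacts [hl, hM.label_eq hq]
    have := Set.ext_iff.1 hlq (⟨p, hS rfl⟩, i)
    simp only [Formula.Sat, Term.eval, h1, h2]
    exact this
  | lt B s t =>
    refine ⟨0, fun f f' v v' M hM hl hB => ?_⟩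
    -- The shift is an arbitrary integer here: x itself has shift 0, which is outside [-N, N) when N
    -- = 0, and terms add further shifts.
    have aux : ∀ y ∈ insert x B, ∃ p p' : ℝ, ∃ i : ℤ, ((p = v x ∧ p' = v' x) ∨ M p p') ∧
        v y = p + i ∧ v' y = p' + i := by
      rintro y (rfl | hy)
      · exact ⟨v y, v' y, 0, .inl ⟨rfl, rfl⟩, by simp, by simp⟩
      · obtain ⟨p, p', i, h⟩ := hB y hy
        exact ⟨p, p', i, h⟩
    obtain ⟨p, p', i, hp, h1, h2⟩ := aux s.head (hfree (.inl s.head_mem_vars))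
    obtain ⟨q, q', j, hq, h3, h4⟩ := aux t.head (hfree (.inr t.head_mem_vars))
    have hcast : ∀ (p : ℝ) (i : ℤ) (n : ℕ), p + i + n = p + ((i + n : ℤ) : ℝ) := by
      intros; push_cast; ring
    simp only [Formula.Sat, Term.eval_eq, h1, h2, h3, h4, hcast]
    exact ⟨add_int_lt_add_int hM hp hq,
      add_int_lt_add_int hM.symm (hp.imp_left And.symm) (hq.imp_left And.symm)⟩
  | and B φ ψ _ _ ih1 ih2 =>
    obtain ⟨k1, h1⟩ := ih1 (fun p hp => hS (.inl hp)) (fun y hy => hfree (.inl hy))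
    obtain ⟨k2, h2⟩ := ih2 (fun p hp => hS (.inr hp)) (fun y hy => hfree (.inr hy))
    exact ⟨max k1 k2, fun f f' v v' M hM hl hB =>
      and_congr (h1 f f' v v' M (hM.mono (le_max_left _ _)) hl hB)
        (h2 f f' v v' M (hM.mono (le_max_right _ _)) hl hB)⟩
  | neg B φ _ ih =>
    obtain ⟨k, h⟩ := ih hS hfree
    exact ⟨k, fun f f' v v' M hM hl hB => not_congr (h f f' v v' M hM hl hB)⟩
  | ex B z hz χ _ ih =>
    obtain ⟨k, h⟩ := ih (fun p hp => hS (.inr hp)) (fun y hy => by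
      by_cases hyz : y = z
      · exact .inr (.inl hyz)
      · exact (hfree ⟨.inr hy, hyz⟩).imp_right .inr)
    have key : ∀ (f f' : Signal P) (v v' : ℕ → ℝ) (M : ℝ → ℝ → Prop),
        Match (label S N f) (label S N f') (k + 1) (v x) (v x + 1) (v' x) (v' x + 1) M →
        label S N f (v x) = label S N f' (v' x) →
        (∀ y ∈ B, Corresponds M (v x) (v' x) N v v' y) →
        (Formula.ex z (.and (.between N x z) χ)).Sat f v →
        (Formula.ex z (.and (.between N x z) χ)).Sat f' v' := by
      rintro f f' v v' M hM hl hB ⟨c, hc, hχ⟩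
      rw [Formula.sat_between] at hc
      simp only [Function.update_self, Function.update_of_ne hz.symm] at hc
      -- The witness c is folded to c - i in [x, x + 1), where i is the integer part of c - x; the
      -- bounds on the quantifier give -N ≤ i < N. The folded point is matched with p', and p' + i
      -- is the witness on the other side.
      have hfl := Int.floor_le (c - v x)
      have hfl' := Int.lt_floor_add_one (c - v x)
      have hi : ⌊c - v x⌋ ∈ Set.Ico (-N : ℤ) N := by
        refine ⟨Int.le_floor.2 ?_, Int.floor_lt.2 ?_⟩
        · push_cast; linarith [hc.1]
        · push_cast; linarith [hc.2]
      generalize ⌊c - v x⌋ = i at hfl hfl' hi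
      obtain ⟨p', M', hM', hMM', hp'⟩ : ∃ p' M',
          Match (label S N f) (label S N f') k (v x) (v x + 1) (v' x) (v' x + 1) M' ∧
          (∀ q q', M q q' → M' q q') ∧ ((c - i = v x ∧ p' = v' x) ∨ M' (c - i) p') := by
        rcases (show v x ≤ c - i by linarith).eq_or_lt with hci | hci
        · exact ⟨v' x, M, hM.lower, fun _ _ h => h, .inl ⟨hci.symm, rfl⟩⟩
        · obtain ⟨p', M', h1, h2, h3⟩ := hM.exists_extend ⟨hci, by linarith⟩
          exact ⟨p', M', h1, h2, .inr h3⟩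
      have hp0 : v' x ≤ p' ∧ p' < v' x + 1 := by
        rcases hp' with ⟨-, rfl⟩ | hp'
        · simp
        · have := (hM'.mem_Ioo hp').2
          exact ⟨this.1.le, this.2⟩
      refine ⟨p' + i, ?_, ?_⟩
      · rw [Formula.sat_between]
        simp only [Function.update_self, Function.update_of_ne hz.symm]
        have h1 : -(N : ℝ) ≤ i := by exact_mod_cast hi.1
        have h2 : (i : ℝ) + 1 ≤ N := by exact_mod_cast hi.2
        constructor <;> linarith
      · have hv : Function.update v z c x = v x := Function.update_of_ne hz.symm _ _
        have hv' : Function.update v' z (p' + i) x = v' x := Function.update_of_ne hz.symm _ _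
        refine (h f f' _ _ M' (by rwa [hv, hv']) (by rwa [hv, hv']) fun y hy => ?_).1 hχ
        rw [hv, hv']
        by_cases hyz : y = z
        · subst hyz
          exact ⟨c - i, p', ⟨i, hi⟩, hp', by simp, by simp⟩
        · obtain ⟨q, q', j, hq, h1, h2⟩ := hB y (hy.resolve_left hyz)
          exact ⟨q, q', j, hq.imp_right (hMM' _ _), by rwa [Function.update_of_ne hyz],
            by rwa [Function.update_of_ne hyz]⟩
    refine ⟨k + 1, fun f f' v v' M hM hl hB => ⟨key f f' v v' M hM hl hB, ?_⟩⟩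
    refine key f' f v' v _ hM.symm hl.symm fun y hy => ?_
    obtain ⟨q, q', j, hq, h1, h2⟩ := hB y hy
    exact ⟨q', q, j, hq.imp_left And.symm, h2, h1⟩

end FOOne

/-! ### Assembling the MTL formula -/

theorem theorem3 {P : Type*} (N x : ℕ) (φ : FOOne.Formula P) (hφ : φ.IsBounded N x) :
    ∃ ψ : MTL.Formula P, φ.Equivalent x ψ := by
  obtain ⟨hfree, hbet⟩ := hφ
  obtain ⟨k, hk⟩ := hbet.exists_depth (S := φ.preds) subset_rfl
    (hfree.trans fun y hy => .inl hy)
  have : Finite φ.preds := φ.finite_preds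
  have hl : ∀ y, MTL.Definable (fun f r => y ∈ FOOne.label φ.preds N f r) := fun y =>
    (MTL.Definable.atom (y.1 : P)).add_int y.2
  -- Only the value at x matters: two assignments agreeing there are compared by matching the unit
  -- interval with itself, with no inner points.
  suffices h : MTL.Definable fun f r => ∃ v : ℕ → ℝ, v x = r ∧ φ.Sat f v by
    obtain ⟨ψ, hψ⟩ := h
    refine ⟨ψ, fun f r v hv => Iff.trans ⟨fun h => ⟨v, hv, h⟩, ?_⟩ (hψ f r)⟩
    rintro ⟨v', hv', h⟩
    refine (hk f f v v' (fun _ _ => False) ?_ (by rw [hv, hv']) (by simp)).2 h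
    rw [hv, hv']
    exact .leaf (lt_add_one r) (lt_add_one r) rfl
  -- The pairs (type, label) realized by some model of the formula, over all signals; the MTL
  -- formula is their finite disjunction.
  let good : Set (MTL.IntervalType _ k × Set _) := {e | ∃ (f : Signal P) (v : ℕ → ℝ),
    φ.Sat f v ∧ (MTL.intervalType (FOOne.label φ.preds N f) k (v x) (v x + 1),
      FOOne.label φ.preds N f (v x)) = e}
  refine (MTL.Definable.exists_finite fun e : good =>
    ((MTL.Decomposable.intervalType_eq hl k e.1.1).definable one_pos).and
      (MTL.Definable.label_eq hl e.1.2)).congr fun f r => ?_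
  simp only [NNRat.cast_one]
  constructor
  · rintro ⟨⟨_, f', v', h, rfl⟩, h1, h2⟩
    refine ⟨fun _ => r, rfl, (hk f f' _ v' _ (.leaf (lt_add_one _) (lt_add_one _) h1) h2
      (by simp)).2 h⟩
  · rintro ⟨v, rfl, h⟩
    exact ⟨⟨_, f, v, h, rfl⟩, rfl, rfl⟩
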